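/- A finite group $G$ is called a Leinster group if the sum of the orders of all its normal subgroups (including the trivial subgroup and $G$ itself) equals $2|G|$. Theorem. If $p<q<r<s$ are primes and $G$ is a group of order $pqrs$, then $G$ is not a Leinster group. -/

import Mathlib

/-- The sum `σ(G)` of the orders of the normal subgroups of `G` (meant for finite `G`). -/
noncomputable def normalSubgroupOrderSum (G : Type*) [Group G] : ℕ :=
  ∑ᶠ N : {N : Subgroup G // N.Normal}, Nat.card N.1

/-- A Leinster group: a finite group for which the sum of the orders of its normal subgroups
(including the trivial subgroup and the whole group) is twice the order of the group. -/
def IsLeinster (G : Type*) [Group G] : Prop :=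
  Finite G ∧ normalSubgroupOrderSum G = 2 * Nat.card G

/-! ### Normal subgroups in a group of squarefree order -/

namespace Subgroup

variable {G : Type*} [Group G]

/-! In a group of squarefree order a normal subgroup is determined by its order, and joins and meets
of normal subgroups correspond to unions and intersections of sets of prime divisors. The normal
subgroups thus form a finite distributive lattice, encoded by the relation "`a` forces `b`"
(`NormalForces`): they correspond to the sets of primes closed under forcing, and the sum of their
orders is the sum of the products over closed sets (`normalSubgroupOrderSum_eq_sum_powerset`).

Group theory restricts forcing between distinct primes. If `a` forces `b`, then `b` divides the
order of the cyclic group `G'`, so there is a normal subgroup of order `b`. Hence `b` forces no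
other prime, and Burnside transfer in the centralizer of that subgroup gives `a ∣ b - 1`. With four
primes few relations remain up to relabelling; each gives a Diophantine equation, refuted by parity,
divisibility or size. -/

theorem card_sup_mul_card_inf (N M : Subgroup G) [N.Normal] :
    Nat.card (N ⊔ M : Subgroup G) * Nat.card (N ⊓ M : Subgroup G) = Nat.card N * Nat.card M := by
  have h1 := relIndex_mul_relIndex ⊥ N (N ⊔ M) bot_le le_sup_left
  have h2 := relIndex_mul_relIndex ⊥ (N ⊓ M) M bot_le inf_le_right
  rw [relIndex_sup_left, relIndex_bot_left, relIndex_bot_left] at h1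
  rw [inf_relIndex_right, relIndex_bot_left, relIndex_bot_left] at h2
  rw [← h1, ← h2]
  ring

theorem card_sup_dvd_mul (N M : Subgroup G) [N.Normal] :
    Nat.card (N ⊔ M : Subgroup G) ∣ Nat.card N * Nat.card M :=
  Dvd.intro _ (card_sup_mul_card_inf N M)

/-- The order of `N ⊔ M` divides the square of `Nat.card N` and is squarefree, so it divides
`Nat.card N`; both subgroups therefore equal their join. -/
theorem eq_of_card_eq_of_squarefree (hG : Squarefree (Nat.card G)) {N M : Subgroup G} [N.Normal]
    (h : Nat.card N = Nat.card M) : N = M := by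
  have : Finite G := Nat.finite_of_card_ne_zero hG.ne_zero
  have hsq : Squarefree (Nat.card (N ⊔ M : Subgroup G)) :=
    hG.squarefree_of_dvd (card_subgroup_dvd_card _)
  have hd : Nat.card (N ⊔ M : Subgroup G) ∣ Nat.card N := by
    rw [← hsq.dvd_pow_iff_dvd two_ne_zero, sq]
    conv_rhs => rw [h]
    exact h ▸ card_sup_dvd_mul N M
  have h1 := eq_of_le_of_card_ge (le_sup_left : N ≤ N ⊔ M) (Nat.le_of_dvd Nat.card_pos hd)
  have h2 := eq_of_le_of_card_ge (le_sup_right : M ≤ N ⊔ M)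
    (h ▸ Nat.le_of_dvd Nat.card_pos hd)
  exact h1.trans h2.symm

theorem characteristic_of_squarefree (hG : Squarefree (Nat.card G)) (N : Subgroup G) [N.Normal] :
    N.Characteristic :=
  characteristic_iff_map_eq.2 fun φ ↦ (eq_of_card_eq_of_squarefree hG
    (Nat.card_congr (N.equivMapOfInjective φ.toMonoidHom φ.injective).toEquiv)).symm

/-- Otherwise `a ^ 2` would divide the order of `N ⊔ M`. -/
theorem prime_dvd_card_inf (hG : Squarefree (Nat.card G)) {N M : Subgroup G} [N.Normal] {a : ℕ}
    (ha : a.Prime) (hN : a ∣ Nat.card N) (hM : a ∣ Nat.card M) :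
    a ∣ Nat.card (N ⊓ M : Subgroup G) := by
  by_contra h
  have h2 : a ^ 2 ∣ Nat.card (N ⊔ M : Subgroup G) := by
    refine (((Nat.Prime.coprime_iff_not_dvd ha).2 h).pow_left 2).dvd_of_dvd_mul_right ?_
    rw [card_sup_mul_card_inf, sq]
    exact mul_dvd_mul hN hM
  have h3 := (hG.squarefree_of_dvd (card_subgroup_dvd_card (N ⊔ M))) a (sq a ▸ h2)
  exact ha.one_lt.ne' (Nat.isUnit_iff.1 h3)

theorem prime_dvd_card_sup {N M : Subgroup G} [N.Normal] {a : ℕ}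
    (ha : a.Prime) (h : a ∣ Nat.card (N ⊔ M : Subgroup G)) : a ∣ Nat.card N ∨ a ∣ Nat.card M :=
  (ha.dvd_mul).1 (h.trans (card_sup_dvd_mul N M))

/-- The centralizer is the kernel of the conjugation action on `B`, and `Aut B` has order `b - 1`.
-/
theorem index_centralizer_dvd_of_card_prime {b : ℕ} (hb : b.Prime) (B : Subgroup G) [B.Normal]
    (hB : Nat.card B = b) : (centralizer (B : Set G)).index ∣ b - 1 := by
  have := Fact.mk hb
  have : Finite B := Nat.finite_of_card_ne_zero (hB ▸ hb.ne_zero)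
  have hc : IsCyclic B := isCyclic_of_prime_card hB
  have hk : (MulAut.conjNormal : G →* MulAut B).ker = centralizer (B : Set G) := by
    ext g
    rw [MonoidHom.mem_ker, mem_centralizer_iff, DFunLike.ext_iff]
    simp only [Subtype.forall, Subtype.ext_iff, MulAut.conjNormal_apply, MulAut.one_apply,
      SetLike.mem_coe]
    refine forall₂_congr fun h _ ↦ ?_
    rw [mul_inv_eq_iff_eq_mul, eq_comm]
  rw [← hk, index_ker]
  refine (card_subgroup_dvd_card _).trans ?_
  rw [IsCyclic.card_mulAut, hB, Nat.totient_prime hb]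

end Subgroup

/-- Every normal subgroup of `G` whose order is divisible by `a` has order divisible by `b`. -/
def NormalForces (G : Type*) [Group G] (a b : ℕ) : Prop :=
  ∀ N : Subgroup G, N.Normal → a ∣ Nat.card N → b ∣ Nat.card N

namespace NormalForces

variable {G : Type*} [Group G] {a b : ℕ}

open Subgroup

/-- For `x` of order `a`, the subgroup generated by `G'` and `x` contains `G'`, hence is normal, and
so has order divisible by `b`. The factor `b` cannot come from `x`. -/
theorem prime_dvd_card_commutator [Finite G] (ha : a.Prime) (hb : b.Prime) (hab : a ≠ b)
    (haG : a ∣ Nat.card G) (h : NormalForces G a b) : b ∣ Nat.card (commutator G) := by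
  have := Fact.mk ha
  obtain ⟨x, hx⟩ := exists_prime_orderOf_dvd_card' a haG
  have hN : (commutator G ⊔ zpowers x).Normal := Normal.of_commutator_le _ le_sup_left
  have hax : a ∣ Nat.card (commutator G ⊔ zpowers x : Subgroup G) := by
    rw [← hx, ← Nat.card_zpowers]
    exact card_dvd_of_le le_sup_right
  refine (prime_dvd_card_sup hb (h _ hN hax)).resolve_right fun hbx ↦ ?_
  rw [Nat.card_zpowers, hx, Nat.prime_dvd_prime_iff_eq hb ha] at hbx
  exact hab hbx.symm

end NormalForces

/-! ### Forcing between primes, and closed sets of primes -/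

section Squarefree

open Subgroup

variable {G : Type*} [Group G] {a b : ℕ}

/-- All Sylow subgroups are cyclic, so `G'` is cyclic, and its subgroup of order `b` is
characteristic. -/
theorem exists_normal_card_eq_of_dvd_card_commutator (hG : Squarefree (Nat.card G))
    (hb : b.Prime) (h : b ∣ Nat.card (commutator G)) :
    ∃ B : Subgroup G, B.Normal ∧ Nat.card B = b := by
  have : Finite G := Nat.finite_of_card_ne_zero hG.ne_zero
  have : IsZGroup G := IsZGroup.of_squarefree hG
  have := Fact.mk hb
  have hc := IsZGroup.isCyclic_commutator (G := G)
  let _ : CommGroup (commutator G) := IsCyclic.commGroup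
  obtain ⟨x, hx⟩ := exists_prime_orderOf_dvd_card' b h
  have hchar : (zpowers x).Characteristic :=
    characteristic_of_squarefree (hG.squarefree_of_dvd (card_subgroup_dvd_card _)) _
  refine ⟨(zpowers x).map (commutator G).subtype, inferInstance, ?_⟩
  rw [card_map_of_injective (subtype_injective _), Nat.card_zpowers, hx]

theorem exists_normal_of_not_dvd_sub_one (hG : Squarefree (Nat.card G))
    (ha : a.Prime) (hb : b.Prime) (hab : a ≠ b) (haG : a ∣ Nat.card G) (hdvd : ¬ a ∣ b - 1)
    (B : Subgroup G) [B.Normal] (hB : Nat.card B = b) :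
    ∃ N : Subgroup G, N.Normal ∧ a ∣ Nat.card N ∧ ¬ b ∣ Nat.card N := by
  have : Finite G := Nat.finite_of_card_ne_zero hG.ne_zero
  have := Fact.mk hb
  let C := centralizer (B : Set G)
  have haC : a ∣ Nat.card C := by
    rw [← card_mul_index C] at haG
    exact (ha.dvd_mul.1 haG).resolve_right
      fun h ↦ hdvd (h.trans (index_centralizer_dvd_of_card_prime hb B hB))
  have hC : Squarefree (Nat.card C) := hG.squarefree_of_dvd (card_subgroup_dvd_card _)
  have hcyc : IsCyclic B := isCyclic_of_prime_card hB
  have hBC : B ≤ C := by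
    let _ : CommGroup B := IsCyclic.commGroup
    intro x hx
    rw [mem_centralizer_iff]
    intro y hy
    exact congrArg Subtype.val (mul_comm (⟨y, hy⟩ : B) ⟨x, hx⟩)
  have hcard : Nat.card (B.subgroupOf C) = b := by
    rw [Nat.card_congr (subgroupOfEquivOfLe hBC).toEquiv, hB]
  have hidx : ¬ b ∣ (B.subgroupOf C).index := by
    intro h
    have h2 : b * b ∣ Nat.card C := by
      rw [← card_mul_index (B.subgroupOf C), hcard]
      exact mul_dvd_mul_left b h
    exact hb.one_lt.ne' (Nat.isUnit_iff.1 (hC b h2))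
  -- `B` is a central Sylow `b`-subgroup of its centralizer `C`, so Burnside's transfer theorem
  -- supplies a normal complement `K`. It is characteristic in `C`, hence normal in `G`.
  let P : Sylow b C := (IsPGroup.of_card (n := 1) (by rw [hcard, pow_one])).toSylow hidx
  have hPc : normalizer (P : Set C) ≤ centralizer (P : Set C) := by
    intro g _
    rw [mem_centralizer_iff]
    intro y hy
    have hy' : (y : G) ∈ B := hy
    exact Subtype.ext (mem_centralizer_iff.1 g.2 _ hy')
  have hcompl := MonoidHom.ker_transferSylow_isComplement' P hPc
  have hK := hcompl.card_mul_card
  have hnd := MonoidHom.not_dvd_card_ker_transferSylow P hPc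
  set K := (MonoidHom.transferSylow P hPc).ker
  have hchar : K.Characteristic := characteristic_of_squarefree hC K
  have hKc : Nat.card (K.map C.subtype) = Nat.card K :=
    card_map_of_injective (subtype_injective _)
  refine ⟨K.map C.subtype, inferInstance, ?_, hKc ▸ hnd⟩
  have hPb : Nat.card (P : Subgroup C) = b := hcard
  rw [hPb] at hK
  rw [hKc]
  rw [← hK] at haC
  exact (ha.dvd_mul.1 haC).resolve_right
    fun h ↦ hab ((Nat.prime_dvd_prime_iff_eq ha hb).1 h)

theorem NormalForces.dvd_sub_one (hG : Squarefree (Nat.card G)) (ha : a.Prime) (hb : b.Prime)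
    (hab : a ≠ b) (haG : a ∣ Nat.card G) (h : NormalForces G a b) : a ∣ b - 1 := by
  have : Finite G := Nat.finite_of_card_ne_zero hG.ne_zero
  obtain ⟨B, hBn, hB⟩ := exists_normal_card_eq_of_dvd_card_commutator hG hb
    (h.prime_dvd_card_commutator ha hb hab haG)
  by_contra hd
  obtain ⟨N, hN, h1, h2⟩ := exists_normal_of_not_dvd_sub_one hG ha hb hab haG hd B hB
  exact h2 (h N hN h1)

/-- The normal subgroup of order `b` has no other prime divisor, so forcing has no chains of length
two. -/
theorem NormalForces.not_normalForces (hG : Squarefree (Nat.card G)) (ha : a.Prime) (hb : b.Prime)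
    (hab : a ≠ b) (haG : a ∣ Nat.card G) (h : NormalForces G a b) {c : ℕ} (hc : c.Prime)
    (hbc : b ≠ c) : ¬ NormalForces G b c := by
  have : Finite G := Nat.finite_of_card_ne_zero hG.ne_zero
  obtain ⟨B, hBn, hB⟩ := exists_normal_card_eq_of_dvd_card_commutator hG hb
    (h.prime_dvd_card_commutator ha hb hab haG)
  intro h'
  have := h' B hBn hB.symm.dvd
  rw [hB, Nat.prime_dvd_prime_iff_eq hc hb] at this
  exact hbc this.symm

theorem exists_normal_prime_dvd_card_iff (hG : Squarefree (Nat.card G)) {S : Finset ℕ}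
    (hS : S ⊆ (Nat.card G).primeFactors)
    (hcl : ∀ a ∈ S, ∀ b ∈ (Nat.card G).primeFactors, NormalForces G a b → b ∈ S) :
    ∃ N : Subgroup G, N.Normal ∧ (Nat.card N).primeFactors = S := by
  classical
  have : Finite G := Nat.finite_of_card_ne_zero hG.ne_zero
  -- For fixed `a`, intersect the normal subgroups witnessing that `a` does not force `c`, over all
  -- `c` outside `S`.
  have key : ∀ a ∈ S, ∀ T ⊆ (Nat.card G).primeFactors \ S, ∃ N : Subgroup G, N.Normal ∧
      a ∣ Nat.card N ∧ ∀ b ∈ T, ¬ b ∣ Nat.card N := by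
    intro a ha T
    have haP := Nat.prime_of_mem_primeFactors (hS ha)
    induction T using Finset.induction_on with
    | empty =>
      exact fun _ ↦ ⟨⊤, inferInstance, by simpa using Nat.dvd_of_mem_primeFactors (hS ha), by simp⟩
    | insert c T _ ih =>
      intro hT
      obtain ⟨N, hN, haN, hNT⟩ := ih ((Finset.subset_insert _ _).trans hT)
      have hc := Finset.mem_sdiff.1 (hT (Finset.mem_insert_self _ _))
      have hac : ¬ NormalForces G a c := fun h ↦ hc.2 (hcl a ha c hc.1 h)
      simp only [NormalForces, not_forall] at hac
      obtain ⟨M, hM, haM, hcM⟩ := hac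
      refine ⟨N ⊓ M, inferInstance, prime_dvd_card_inf hG haP haN haM, fun b hb ↦ ?_⟩
      rcases Finset.mem_insert.1 hb with rfl | hb
      · exact fun h ↦ hcM (h.trans (card_dvd_of_le inf_le_right))
      · exact fun h ↦ hNT b hb (h.trans (card_dvd_of_le inf_le_left))
  -- The join of the subgroups from `key` over all `a ∈ S` acquires no prime outside `S`.
  have key2 : ∀ T ⊆ S, ∃ N : Subgroup G, N.Normal ∧ (∀ a ∈ T, a ∣ Nat.card N) ∧
      ∀ b ∈ (Nat.card G).primeFactors \ S, ¬ b ∣ Nat.card N := by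
    intro T
    induction T using Finset.induction_on with
    | empty =>
      refine fun _ ↦ ⟨⊥, inferInstance, by simp, fun b hb h ↦ ?_⟩
      rw [card_bot] at h
      exact (Nat.prime_of_mem_primeFactors (Finset.mem_sdiff.1 hb).1).one_lt.ne'
        (Nat.dvd_one.1 h)
    | insert c T _ ih =>
      intro hT
      obtain ⟨N, hN, haN, hNT⟩ := ih ((Finset.subset_insert _ _).trans hT)
      obtain ⟨M, hM, hcM, hMT⟩ := key c (hT (Finset.mem_insert_self _ _)) _ subset_rfl
      refine ⟨N ⊔ M, inferInstance, fun a ha ↦ ?_, fun b hb h ↦ ?_⟩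
      · rcases Finset.mem_insert.1 ha with rfl | ha
        · exact hcM.trans (card_dvd_of_le le_sup_right)
        · exact (haN a ha).trans (card_dvd_of_le le_sup_left)
      · exact (prime_dvd_card_sup (Nat.prime_of_mem_primeFactors (Finset.mem_sdiff.1 hb).1)
          h).elim (hNT b hb) (hMT b hb)
  obtain ⟨N, hN, h1, h2⟩ := key2 S subset_rfl
  refine ⟨N, hN, ?_⟩
  ext b
  constructor
  · intro hb
    by_contra hbS
    exact h2 b (Finset.mem_sdiff.2 ⟨Nat.primeFactors_mono (card_subgroup_dvd_card N)
      hG.ne_zero hb, hbS⟩) (Nat.dvd_of_mem_primeFactors hb)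
  · exact fun hb ↦ Nat.mem_primeFactors.2
      ⟨Nat.prime_of_mem_primeFactors (hS hb), h1 b hb, Nat.card_pos.ne'⟩

open Classical in
theorem normalSubgroupOrderSum_eq_sum_powerset (hG : Squarefree (Nat.card G)) :
    normalSubgroupOrderSum G = ∑ S ∈ (Nat.card G).primeFactors.powerset,
      if ∀ a ∈ S, ∀ b ∈ (Nat.card G).primeFactors, NormalForces G a b → b ∈ S
      then ∏ a ∈ S, a else 0 := by
  have : Finite G := Nat.finite_of_card_ne_zero hG.ne_zero
  have hsq (N : Subgroup G) : Squarefree (Nat.card N) :=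
    hG.squarefree_of_dvd (card_subgroup_dvd_card N)
  have := Fintype.ofFinite {N : Subgroup G // N.Normal}
  rw [normalSubgroupOrderSum, finsum_eq_sum_of_fintype, ← Finset.sum_filter]
  refine Finset.sum_bij (fun N _ ↦ (Nat.card N.1).primeFactors) ?_ ?_ ?_ ?_
  · intro N _
    refine Finset.mem_filter.2 ⟨Finset.mem_powerset.2
      (Nat.primeFactors_mono (card_subgroup_dvd_card N.1) hG.ne_zero), fun a ha b hb h ↦ ?_⟩
    exact Nat.mem_primeFactors.2 ⟨Nat.prime_of_mem_primeFactors hb,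
      h N.1 N.2 (Nat.dvd_of_mem_primeFactors ha), Nat.card_pos.ne'⟩
  · intro N _ M _ h
    have := N.2
    refine Subtype.ext (eq_of_card_eq_of_squarefree hG ?_)
    rw [← Nat.prod_primeFactors_of_squarefree (hsq N.1),
      ← Nat.prod_primeFactors_of_squarefree (hsq M.1)]
    exact congrArg (fun S ↦ ∏ a ∈ S, a) h
  · intro S hS
    obtain ⟨h1, h2⟩ := Finset.mem_filter.1 hS
    obtain ⟨N, hN, h⟩ := exists_normal_prime_dvd_card_iff hG (Finset.mem_powerset.1 h1) h2
    exact ⟨⟨N, hN⟩, Finset.mem_univ _, h⟩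
  · exact fun N _ ↦ (Nat.prod_primeFactors_of_squarefree (hsq N.1)).symm

end Squarefree

/-! ### The Diophantine equations -/

section Diophantine

variable {a b c d e : ℕ}

theorem two_dvd_succ_of_odd (h : Odd a) : 2 ∣ a + 1 := h.add_one.two_dvd

theorem Nat.Prime.odd_of_lt (hb : b.Prime) (ha : a.Prime) (hab : a < b) : Odd b :=
  hb.odd_of_ne_two (by have := ha.two_le; omega)

theorem four_mul_ne_two_mul_odd {x y : ℕ} (hy : Odd y) : 4 * x ≠ 2 * y := by
  obtain ⟨k, rfl⟩ := hy
  omega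

/-- The case without forcing. The left side is divisible by 8, as `b`, `c`, `d` are odd, but the
right side is not. -/
theorem prod_succ_ne_two_mul_prod (ha : a.Prime) (hb : b.Prime) (hc : c.Prime) (hd : d.Prime)
    (hab : a < b) (hac : a < c) (had : a < d) :
    (a + 1) * (b + 1) * (c + 1) * (d + 1) ≠ 2 * (a * b * c * d) := by
  intro h
  have ob := hb.odd_of_lt ha hab
  have oc := hc.odd_of_lt ha hac
  have od := hd.odd_of_lt ha had
  obtain ⟨x, hx⟩ := two_dvd_succ_of_odd ob
  obtain ⟨y, hy⟩ := two_dvd_succ_of_odd oc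
  obtain ⟨z, hz⟩ := two_dvd_succ_of_odd od
  rw [hx, hy, hz] at h
  rcases ha.eq_two_or_odd' with rfl | oa
  · exact four_mul_ne_two_mul_odd (x := 3 * x * y * z) ((ob.mul oc).mul od) (by linarith)
  · exact four_mul_ne_two_mul_odd (x := (a + 1) * 2 * x * y * z) (((oa.mul ob).mul oc).mul od)
      (by linarith)

/-- The case where `a` forces the other three primes; the obstruction is again 2-adic. -/
theorem prod_add_prod_succ_ne_two_mul_prod (ha : a.Prime) (hb : b.Prime) (hc : c.Prime)
    (hd : d.Prime) (hab : a < b) (hac : a < c) (had : a < d) :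
    a * b * c * d + (b + 1) * (c + 1) * (d + 1) ≠ 2 * (a * b * c * d) := by
  intro h
  have ob := hb.odd_of_lt ha hab
  have oc := hc.odd_of_lt ha hac
  have od := hd.odd_of_lt ha had
  obtain ⟨x, hx⟩ := two_dvd_succ_of_odd ob
  obtain ⟨y, hy⟩ := two_dvd_succ_of_odd oc
  obtain ⟨z, hz⟩ := two_dvd_succ_of_odd od
  rw [hx, hy, hz] at h
  rcases ha.eq_two_or_odd' with rfl | oa
  · exact four_mul_ne_two_mul_odd (x := 2 * x * y * z) ((ob.mul oc).mul od) (by linarith)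
  · exact four_mul_ne_two_mul_odd (x := 4 * x * y * z) (((oa.mul ob).mul oc).mul od)
      (by linarith)

theorem one_lower_one_upper_even (ha : a.Prime) (hb : b.Prime) (he : e.Prime) (hab : a < b)
    (ha2 : a ≠ 2) : (2 + 1) * (e + 1) * (b * (a + 1) + 1) ≠ 2 * (a * b * 2 * e) := by
  intro h
  -- The factor `2 + 1` on the left forces 3 to be one of the odd primes; with `a = 3` or `e = 3`
  -- the left side is too large.
  have h3 : 3 ∣ a * b * e := by
    refine (Nat.Coprime.dvd_of_dvd_mul_left (by norm_num : Nat.Coprime 3 4)) ?_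
    exact Dvd.intro ((e + 1) * (b * (a + 1) + 1)) (by linarith)
  rw [Nat.prime_three.dvd_mul, Nat.prime_three.dvd_mul, Nat.prime_dvd_prime_iff_eq Nat.prime_three ha,
    Nat.prime_dvd_prime_iff_eq Nat.prime_three hb, Nat.prime_dvd_prime_iff_eq Nat.prime_three he] at h3
  rcases h3 with (rfl | rfl) | rfl
  · nlinarith
  · have := ha.two_le
    omega
  · nlinarith

/-- The prime `b` is forced by `a` only. -/
theorem one_lower_one_upper (ha : a.Prime) (hb : b.Prime) (hc : c.Prime) (he : e.Prime)
    (hab : a < b) (hac : a ≠ c) (hae : a ≠ e) (hce : c ≠ e) :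
    (c + 1) * (e + 1) * (b * (a + 1) + 1) ≠ 2 * (a * b * c * e) := by
  intro h
  have ob := hb.odd_of_lt ha hab
  rcases hc.eq_two_or_odd' with rfl | oc
  · exact one_lower_one_upper_even ha hb he hab hac h
  rcases he.eq_two_or_odd' with rfl | oe
  · exact one_lower_one_upper_even ha hb hc hab hae (by linarith)
  obtain ⟨x, hx⟩ := two_dvd_succ_of_odd oc
  obtain ⟨y, hy⟩ := two_dvd_succ_of_odd oe
  rw [hx, hy] at h
  rcases ha.eq_two_or_odd' with rfl | oa
  · obtain ⟨z, hz⟩ : 2 ∣ b * (2 + 1) + 1 := two_dvd_succ_of_odd (ob.mul (by decide))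
    rw [hz] at h
    exact four_mul_ne_two_mul_odd (x := x * y * z) ((ob.mul oc).mul oe) (by linarith)
  · exact four_mul_ne_two_mul_odd (x := x * y * (b * (a + 1) + 1))
      (((oa.mul ob).mul oc).mul oe) (by linarith)

theorem coprime_mul_add_one (x y : ℕ) : Nat.Coprime x (x * y + 1) := by
  simp

/-- Equality holds at `{3, 5}`, the smallest pair of distinct odd primes. -/
theorem five_mul_succ_mul_succ_le (ha : 3 ≤ a) (hc : 3 ≤ c) (hac : 8 ≤ a + c) :
    5 * ((a + 1) * (c + 1)) ≤ 8 * (a * c) := by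
  obtain ⟨x, rfl⟩ := Nat.exists_eq_add_of_le ha
  obtain ⟨y, rfl⟩ := Nat.exists_eq_add_of_le hc
  nlinarith [Nat.zero_le (x * y)]

theorem Nat.Prime.eight_le_add (ha : a.Prime) (hc : c.Prime) (ha2 : a ≠ 2) (hc2 : c ≠ 2)
    (hac : a ≠ c) : 3 ≤ a ∧ 3 ≤ c ∧ 8 ≤ a + c := by
  obtain ⟨x, hx⟩ := ha.odd_of_ne_two ha2
  obtain ⟨y, hy⟩ := hc.odd_of_ne_two hc2
  have := ha.two_le
  have := hc.two_le
  omega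

theorem Nat.Prime.five_le (hc : c.Prime) (h2 : c ≠ 2) (h3 : c ≠ 3) : 5 ≤ c := by
  obtain ⟨x, hx⟩ := hc.odd_of_ne_two h2
  have := hc.two_le
  omega

theorem two_mul_add_one_le_of_dvd_sub_one (hc : Odd c) (hb : Odd b) (h1 : 1 < b)
    (h : c ∣ b - 1) : 2 * c + 1 ≤ b := by
  obtain ⟨m, hm⟩ := h
  have hev : Even (c * m) := hm ▸ Nat.Odd.sub_odd hb odd_one
  rcases Nat.even_mul.1 hev with h | h
  · exact absurd h (Nat.not_even_iff_odd.2 hc)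
  · obtain ⟨k, rfl⟩ := h
    have : k ≠ 0 := by
      rintro rfl
      simp at hm
      omega
    have : c * 1 ≤ c * k := Nat.mul_le_mul_left c (by omega)
    have : c * (k + k) = c * k + c * k := by ring
    omega

/-- The case `a = 2` of `one_lower_two_upper`, after `e` is eliminated by `e + 1 = b * k`. It reads
`k * b * (c - 3) = k + 4 * c`, impossible since `b ≥ 2 * c + 1`. -/
theorem one_lower_two_upper_even {k : ℕ} (hc : c.Prime) (hb : b.Prime) (hc2 : c ≠ 2)
    (hcb : c ∣ b - 1) (hlt : c < b) (hk : 0 < k)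
    (h : k * (b * (2 + 1) * (c + 1) + 1) + 4 * c = 4 * c * b * k) : False := by
  have hbc := two_mul_add_one_le_of_dvd_sub_one (hc.odd_of_ne_two hc2) (hb.odd_of_lt hc hlt)
    hb.one_lt hcb
  by_cases h3 : c = 3
  · subst h3
    nlinarith
  obtain ⟨x, rfl⟩ := Nat.exists_eq_add_of_le (hc.five_le hc2 h3)
  have h4 : k * (b * (x + 2)) = k + 4 * (5 + x) := by nlinarith
  have h5 : k * ((2 * (5 + x) + 1) * 2) ≤ k * (b * (x + 2)) :=
    Nat.mul_le_mul_left k (Nat.mul_le_mul hbc (by omega))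
  nlinarith

/-- The prime `b` is forced by `a` and `c` only. -/
theorem one_lower_two_upper (ha : a.Prime) (hb : b.Prime) (hc : c.Prime)
    (hab : a < b) (hcb : c < b) (hac : a ≠ c) (hadvd : a ∣ b - 1) (hcdvd : c ∣ b - 1) :
    (e + 1) * (b * (a + 1) * (c + 1) + 1) ≠ 2 * (a * b * c * e) := by
  intro h
  obtain ⟨k, hk⟩ : b ∣ e + 1 := by
    refine Nat.Coprime.dvd_of_dvd_mul_right (k := b) (n := b * ((a + 1) * (c + 1)) + 1)
      (coprime_mul_add_one _ _) ?_
    exact Dvd.intro (2 * (a * c * e)) (by linarith)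
  have hk0 : 0 < k := Nat.pos_of_ne_zero fun h0 ↦ by simp [h0] at hk
  have hb0 := hb.pos
  -- Substitute `e + 1 = b * k` and cancel `b`; what remains is a comparison of sizes.
  have h' : k * (b * (a + 1) * (c + 1) + 1) + 2 * (a * c) = 2 * (a * c) * (b * k) := by
    have h1 : b * (k * (b * (a + 1) * (c + 1) + 1)) = b * (2 * (a * c * e)) := by
      rw [← mul_assoc, ← hk]
      linarith
    rw [Nat.eq_of_mul_eq_mul_left hb0 h1, ← hk]
    ring
  by_cases ha2 : a = 2
  · subst ha2
    exact one_lower_two_upper_even hc hb hac.symm hcdvd hcb hk0 (by linarith)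
  by_cases hc2 : c = 2
  · subst hc2
    exact one_lower_two_upper_even ha hb ha2 hadvd hab hk0 (by linarith)
  obtain ⟨h3a, h3c, h8⟩ := ha.eight_le_add hc ha2 hc2 hac
  have h5 := Nat.mul_le_mul_left (k * b) (five_mul_succ_mul_succ_le h3a h3c h8)
  have h6 : 2 * (k * b * (a * c)) ≤ 5 * k + 10 * (a * c) := by nlinarith
  have hb7 : 7 ≤ b := by
    have := two_mul_add_one_le_of_dvd_sub_one (ha.odd_of_ne_two ha2) (hb.odd_of_lt ha hab)
      hb.one_lt hadvd
    omega
  have hac9 : 9 ≤ a * c := Nat.mul_le_mul h3a h3c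
  have h7 : k * 7 * (a * c) ≤ k * b * (a * c) :=
    Nat.mul_le_mul_right _ (Nat.mul_le_mul_left k hb7)
  have h8 : k * 9 ≤ k * (a * c) := Nat.mul_le_mul_left k hac9
  have h9 : 1 * (a * c) ≤ k * (a * c) := Nat.mul_le_mul_right _ hk0
  linarith

/-- The prime `b` is forced by `a`, `c` and `e`. -/
theorem one_lower_three_upper (hb : b.Prime) :
    b * (a + 1) * (c + 1) * (e + 1) + 1 ≠ 2 * (a * b * c * e) := by
  intro h
  have h1 : b ∣ b * ((a + 1) * (c + 1) * (e + 1)) + 1 :=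
    Dvd.intro (2 * (a * c * e)) (by linarith)
  exact hb.one_lt.ne' (Nat.dvd_one.1 ((Nat.dvd_add_right (Dvd.intro _ rfl)).1 h1))

theorem not_dvd_succ_of_lt (hb : Odd b) (hd : Odd d) (hbd : b < d) : ¬ d ∣ b + 1 := by
  intro h
  have := Nat.le_of_dvd (by omega) h
  obtain ⟨x, rfl⟩ := hb
  obtain ⟨y, rfl⟩ := hd
  omega

theorem two_lower_common_upper_of_lt (ha : a.Prime) (hb : b.Prime) (hc : c.Prime) (hd : d.Prime)
    (hab : a < b) (hbd : b < d) :
    (c + 1) * (a * b * d + (b + 1) * (d + 1)) ≠ 2 * (a * b * c * d) := by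
  intro h
  have ob := hb.odd_of_lt ha hab
  have od := hd.odd_of_lt hb hbd
  obtain ⟨k, hk⟩ : d ∣ c + 1 := by
    have h1 : d ∣ (c + 1) * (b + 1) := by
      have h2 : d ∣ d * ((c + 1) * (a * b + (b + 1))) + (c + 1) * (b + 1) :=
        Dvd.intro (2 * (a * b * c)) (by linarith)
      exact (Nat.dvd_add_right (Dvd.intro _ rfl)).1 h2
    exact (hd.dvd_mul.1 h1).resolve_right (not_dvd_succ_of_lt ob od hbd)
  have hk0 : 0 < k := Nat.pos_of_ne_zero fun h0 ↦ by simp [h0] at hk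
  -- Equivalently, `k * (a * b * d - (b + 1) * (d + 1)) = 2 * a * b`, which leaves only small cases.
  have h' : k * (a * b * d + (b + 1) * (d + 1)) + 2 * (a * b) = 2 * (a * b) * (d * k) := by
    have h1 : d * (k * (a * b * d + (b + 1) * (d + 1))) = d * (2 * (a * b * c)) := by
      rw [← mul_assoc, ← hk]
      linarith
    rw [Nat.eq_of_mul_eq_mul_left hd.pos h1, ← hk]
    ring
  have ha0 := ha.two_le
  have hd2 : b + 2 ≤ d := by
    obtain ⟨x, rfl⟩ := ob
    obtain ⟨y, rfl⟩ := od
    omega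
  by_cases ha2 : a = 2
  · subst ha2
    by_cases hb3 : b = 3
    · subst hb3
      -- The only near miss: `d = 5`, `k = 2` gives `c = 9`, which is not prime.
      have h1 : k * (d - 2) = 6 := by
        obtain ⟨x, rfl⟩ := Nat.exists_eq_add_of_le hd2
        have : 3 + 2 + x - 2 = 3 + x := by omega
        rw [this]
        nlinarith
      have h2 : d - 2 ∣ 6 := Dvd.intro_left _ h1
      have h3 : d - 2 ≤ 6 := Nat.le_of_dvd (by norm_num) h2
      have h4 : d = 5 := by
        obtain ⟨x, rfl⟩ := od
        have : x ≤ 3 := by omega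
        interval_cases x <;> simp_all
      subst h4
      have : k = 2 := by omega
      subst this
      have : c = 9 := by omega
      subst this
      norm_num at hc
    · have hb5 := hb.five_le (by omega) hb3
      obtain ⟨x, rfl⟩ := Nat.exists_eq_add_of_le hb5
      obtain ⟨y, rfl⟩ := Nat.exists_eq_add_of_le hd2
      obtain ⟨j, rfl⟩ : 2 ∣ k := by
        have hc1 : Odd c := hc.odd_of_ne_two (by
          rintro rfl
          have := Nat.le_of_dvd (by norm_num) (Dvd.intro _ hk.symm)
          omega)
        have := two_dvd_succ_of_odd hc1
        rw [hk] at this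
        exact (Nat.prime_two.dvd_mul.1 this).resolve_left (by
          rw [← even_iff_two_dvd, Nat.not_even_iff_odd]
          exact od)
      have hj : 1 ≤ j := by omega
      -- This is `j * ((b - 1) * (d - 1) - 2) = 2 * b`, too large on the left even for `j = 1`.
      have h1 : j * ((5 + x) * (5 + x + 2 + y)) =
          j * (5 + x + (5 + x + 2 + y) + 1) + 2 * (5 + x) := by linarith
      have h2 : j * (22 + 6 * x) ≤ j * ((4 + x) * (6 + x + y) - 2) := by
        refine Nat.mul_le_mul_left j (Nat.le_sub_of_add_le ?_)
        nlinarith [Nat.zero_le (x * y), Nat.zero_le (x * x)]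
      have h3 : (4 + x) * (6 + x + y) - 2 + 2 = (4 + x) * (6 + x + y) :=
        Nat.sub_add_cancel (by nlinarith [Nat.zero_le (x * y), Nat.zero_le (x * x)])
      have h4 : j * ((4 + x) * (6 + x + y) - 2) = 2 * (5 + x) := by
        generalize (4 + x) * (6 + x + y) - 2 = t at h3
        have h5 : j * (t + 2) = j * ((4 + x) * (6 + x + y)) := by rw [h3]
        linarith
      nlinarith
  · have ha3 : 3 ≤ a := by omega
    have hb5 := hb.five_le (by omega) (by omega)
    have h1 : 5 * ((b + 1) * (d + 1)) ≤ 7 * (b * d) := by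
      obtain ⟨x, rfl⟩ := Nat.exists_eq_add_of_le hb5
      obtain ⟨y, rfl⟩ := Nat.exists_eq_add_of_le hd2
      nlinarith [Nat.zero_le (x * y), Nat.zero_le (x * x)]
    have h2 := Nat.mul_le_mul_left k h1
    have h3 : k * (b * d) * 3 ≤ k * (b * d) * a := Nat.mul_le_mul_left _ ha3
    have h4 : k * a * b * 7 ≤ k * a * b * d := Nat.mul_le_mul_left _ (by omega)
    have h5 : 1 * (a * b) ≤ k * (a * b) := Nat.mul_le_mul_right _ hk0
    have h6 : 0 < a * b := Nat.mul_pos ha.pos hb.pos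
    nlinarith

/-- The primes `b` and `d` are both forced by `a` only. -/
theorem two_lower_common_upper (ha : a.Prime) (hb : b.Prime) (hc : c.Prime) (hd : d.Prime)
    (hab : a < b) (had : a < d) (hbd : b ≠ d) :
    (c + 1) * (a * b * d + (b + 1) * (d + 1)) ≠ 2 * (a * b * c * d) := by
  rcases hbd.lt_or_gt with h | h
  · exact two_lower_common_upper_of_lt ha hb hc hd hab h
  · intro h1
    exact two_lower_common_upper_of_lt ha hd hc hb had h (by linarith)

theorem two_lower_distinct_uppers_even (hc : c.Prime) (hd : d.Prime)
    (hc2 : c ≠ 2) (hcd : c < d) (hdvd : c ∣ d - 1) :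
    (2 * b + b + 1) * (c * d + d + 1) ≠ 2 * (2 * b * c * d) := by
  intro h
  have oc := hc.odd_of_ne_two hc2
  have od := hd.odd_of_lt hc hcd
  have h1 : d ∣ 2 * b + b + 1 := by
    refine Nat.Coprime.dvd_of_dvd_mul_right (k := d) (n := d * (c + 1) + 1)
      (coprime_mul_add_one _ _) ?_
    exact Dvd.intro (2 * (2 * b * c)) (by linarith)
  have h2 : c ∣ 2 * b + b + 1 := by
    have h3 : c ∣ (2 * b + b + 1) * (c * d + d + 1) :=
      Dvd.intro (2 * (2 * b * d)) (by linarith)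
    refine (hc.dvd_mul.1 h3).resolve_right fun h4 ↦ ?_
    -- Modulo `c` the second factor is 2, because `d ≡ 1`.
    have h5 : c * d + d + 1 = c * d + ((d - 1) + 2) := by
      have := hd.two_le
      omega
    rw [h5] at h4
    have h6 := (Nat.dvd_add_right hdvd).1 ((Nat.dvd_add_right (Dvd.intro _ rfl)).1 h4)
    exact hc2 ((Nat.prime_dvd_prime_iff_eq hc Nat.prime_two).1 h6)
  obtain ⟨m, hm⟩ := (((Nat.coprime_primes hc hd).2 hcd.ne).mul_dvd_of_dvd_of_dvd h2 h1)
  have h7 : m * (c * d + d + 1) = 4 * b := by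
    refine Nat.eq_of_mul_eq_mul_left (Nat.mul_pos hc.pos hd.pos) ?_
    rw [← mul_assoc, ← hm, h]
    ring
  have hodd : Odd (c * d + d + 1) := ((oc.mul od).add_odd od).add_one
  have hcop : Nat.Coprime 4 (c * d + d + 1) :=
    Nat.Coprime.pow_left 2 (Nat.coprime_two_left.2 hodd)
  obtain ⟨j, rfl⟩ : 4 ∣ m := hcop.dvd_of_dvd_mul_right (Dvd.intro _ h7.symm)
  have h8 : j * (c * d + d + 1) = b := by linarith
  -- Substitute `b = j * (c * d + d + 1)` into `3 * b + 1 = 4 * j * c * d`.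
  have h9 : j ∣ j * (3 * (c * d + d + 1)) + 1 := Dvd.intro (4 * (c * d)) (by linarith)
  have h10 : j = 1 := Nat.dvd_one.1 ((Nat.dvd_add_right (Dvd.intro _ rfl)).1 h9)
  subst h10
  have h11 : d ∣ d * (3 * (c + 1)) + 4 := Dvd.intro (4 * c) (by linarith)
  have h12 : d ∣ 2 ^ 2 := (Nat.dvd_add_right (Dvd.intro _ rfl)).1 h11
  have h13 := (Nat.prime_dvd_prime_iff_eq hd Nat.prime_two).1 (hd.dvd_of_dvd_pow h12)
  have := hc.two_le
  omega

/-- The prime `b` is forced by `a` only, and the prime `d` by `c` only. -/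
theorem two_lower_distinct_uppers (ha : a.Prime) (hb : b.Prime) (hc : c.Prime) (hd : d.Prime)
    (hac : a ≠ c) (hab : a < b) (hcd : c < d) (hadvd : a ∣ b - 1) (hcdvd : c ∣ d - 1) :
    (a * b + b + 1) * (c * d + d + 1) ≠ 2 * (a * b * c * d) := by
  intro h
  by_cases ha2 : a = 2
  · subst ha2
    exact two_lower_distinct_uppers_even hc hd hac.symm hcd hcdvd h
  by_cases hc2 : c = 2
  · subst hc2
    exact two_lower_distinct_uppers_even ha hb ha2 hab hadvd (by linarith)
  have ob := hb.odd_of_lt ha hab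
  have od := hd.odd_of_lt hc hcd
  have h1 : Odd (a * b + b + 1) := (((ha.odd_of_ne_two ha2).mul ob).add_odd ob).add_one
  have h2 : Odd (c * d + d + 1) := (((hc.odd_of_ne_two hc2).mul od).add_odd od).add_one
  have h3 := h1.mul h2
  rw [h] at h3
  exact Nat.not_odd_iff_even.2 (even_two_mul _) h3

/-- The prime `b` is forced by `a` only, and the prime `d` by `a` and `c`. -/
theorem two_lower_nested_uppers (ha : a.Prime) (hc : c.Prime)
    (hac : a ≠ c) (hab : a < b) (had : a < d) (hcd : c < d) :
    b * d * (a + 1) * (c + 1) + d * (c + 1) + b + 1 ≠ 2 * (a * b * c * d) := by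
  intro h
  have h0a := ha.two_le
  have h0c := hc.two_le
  have h0d : 3 ≤ d := by omega
  have h0b : 3 ≤ b := by omega
  obtain ⟨k, hk⟩ : d ∣ b + 1 := by
    have h2 : d ∣ d * (b * (a + 1) * (c + 1) + (c + 1)) + (b + 1) :=
      Dvd.intro (2 * (a * b * c)) (by linarith)
    exact (Nat.dvd_add_right (Dvd.intro _ rfl)).1 h2
  -- For `a = 2` and `c ≥ 5` this keeps `b` from being small: `d ≥ 6` gives `b ≥ 5`.
  have hdb : d ≤ b + 1 := Nat.le_of_dvd (by omega) (Dvd.intro _ hk.symm)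
  by_cases ha2 : a = 2
  · subst ha2
    by_cases hc3 : c = 3
    · subst hc3
      nlinarith
    obtain ⟨x, rfl⟩ := Nat.exists_eq_add_of_le (hc.five_le hac.symm hc3)
    have h1 : b * d * (x + 2) = d * (6 + x) + b + 1 := by nlinarith
    have h2 : d * 5 ≤ d * b := Nat.mul_le_mul_left d (by omega)
    have h3 : 6 * b ≤ d * b := Nat.mul_le_mul_right b (by omega)
    have h4 : x * (d * 1) ≤ x * (d * b) := by gcongr; omega
    nlinarith
  by_cases hc2 : c = 2
  · subst hc2
    by_cases ha3 : a = 3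
    · subst ha3
      nlinarith
    obtain ⟨x, rfl⟩ := Nat.exists_eq_add_of_le (ha.five_le ha2 ha3)
    have h1 : b * d * (x + 2) = 3 * d + b + 1 := by nlinarith
    have h2 : d * 5 ≤ d * b := Nat.mul_le_mul_left d (by omega)
    have h3 : 6 * b ≤ d * b := Nat.mul_le_mul_right b (by omega)
    nlinarith [Nat.zero_le (b * d * x)]
  obtain ⟨h3a, h3c, h8⟩ := ha.eight_le_add hc ha2 hc2 hac
  have h5 := Nat.mul_le_mul_left (b * d) (five_mul_succ_mul_succ_le h3a h3c h8)
  have h6 : 2 * (b * d * (a * c)) ≤ 5 * (d * (c + 1)) + 5 * b + 5 := by nlinarith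
  have h7 : b * d * c * 3 ≤ b * d * c * a := Nat.mul_le_mul_left _ h3a
  have h8 : d * c * 4 ≤ d * c * b := Nat.mul_le_mul_left _ (by omega)
  have h9 : b * 12 ≤ b * (d * c) := Nat.mul_le_mul_left _ (Nat.mul_le_mul (by omega : 4 ≤ d) h3c)
  have h10 : d * 3 ≤ d * c := Nat.mul_le_mul_left _ h3c
  nlinarith

/-- The primes `b` and `d` are both forced by `a` and `c`. -/
theorem two_lower_two_common_uppers (ha : a.Prime) (hb : b.Prime) (hd : d.Prime)
    (hab : a < b) (had : a < d) (hbd : b ≠ d) :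
    b * d * (a + 1) * (c + 1) + b + d + 1 ≠ 2 * (a * b * c * d) := by
  intro h
  have ob := hb.odd_of_lt ha hab
  have od := hd.odd_of_lt ha had
  have h1 : d ∣ d * (b * (a + 1) * (c + 1) + 1) + (b + 1) :=
    Dvd.intro (2 * (a * b * c)) (by linarith)
  have h2 : b ∣ b * (d * (a + 1) * (c + 1) + 1) + (d + 1) :=
    Dvd.intro (2 * (a * d * c)) (by linarith)
  -- The larger of `b`, `d` would divide the successor of the smaller.
  rcases hbd.lt_or_gt with hlt | hlt
  · exact not_dvd_succ_of_lt ob od hlt ((Nat.dvd_add_right (Dvd.intro _ rfl)).1 h1)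
  · exact not_dvd_succ_of_lt od ob hlt ((Nat.dvd_add_right (Dvd.intro _ rfl)).1 h2)

end Diophantine

/-! ### Sums over closed sets of four primes -/

theorem Finset.sum_powerset_four {α M : Type*} [DecidableEq α] [AddCommMonoid M] {p q r s : α}
    (hpq : p ≠ q) (hpr : p ≠ r) (hps : p ≠ s) (hqr : q ≠ r) (hqs : q ≠ s) (hrs : r ≠ s)
    (f : Finset α → M) :
    ∑ S ∈ ({p, q, r, s} : Finset α).powerset, f S =
      f ∅ + f {s} + (f {r} + f {r, s}) + (f {q} + f {q, s} + (f {q, r} + f {q, r, s})) +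
      (f {p} + f {p, s} + (f {p, r} + f {p, r, s}) +
        (f {p, q} + f {p, q, s} + (f {p, q, r} + f {p, q, r, s}))) := by
  have h1 (g : Finset α → M) : ∑ S ∈ ({s} : Finset α).powerset, g S = g ∅ + g {s} := by
    rw [← insert_empty_eq s, sum_powerset_insert (notMem_empty s)]
    simp
  have h2 (g : Finset α → M) : ∑ S ∈ ({r, s} : Finset α).powerset, g S =
      g ∅ + g {s} + (g {r} + g {r, s}) := by
    rw [sum_powerset_insert (by simp [hrs]), h1, h1, insert_empty_eq]
  have h3 (g : Finset α → M) : ∑ S ∈ ({q, r, s} : Finset α).powerset, g S =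
      g ∅ + g {s} + (g {r} + g {r, s}) + (g {q} + g {q, s} + (g {q, r} + g {q, r, s})) := by
    rw [sum_powerset_insert (by simp [hqr, hqs]), h2, h2, insert_empty_eq]
  rw [sum_powerset_insert (by simp [hpq, hpr, hps]), h3, h3, insert_empty_eq]

open Classical in
theorem sum_powerset_closed_of_four {p q r s : ℕ} (F : ℕ → ℕ → Prop)
    (hpq : p < q) (hqr : q < r) (hrs : r < s) 
    (hF : ∀ a ∈ ({p, q, r, s} : Finset ℕ), ∀ b ∈ ({p, q, r, s} : Finset ℕ), b < a → ¬ F a b) :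
    (∑ S ∈ ({p, q, r, s} : Finset ℕ).powerset,
      if ∀ a ∈ S, ∀ b ∈ ({p, q, r, s} : Finset ℕ), F a b → b ∈ S then ∏ a ∈ S, a else 0) =
    1 + (if ¬ F p q ∧ ¬ F p r ∧ ¬ F p s then p else 0) + (if ¬ F q r ∧ ¬ F q s then q else 0) +
    (if ¬ F r s then r else 0) + s +
    (if ¬ F p r ∧ ¬ F p s ∧ ¬ F q r ∧ ¬ F q s then p * q else 0) +
    (if ¬ F p q ∧ ¬ F p s ∧ ¬ F r s then p * r else 0) +
    (if ¬ F p q ∧ ¬ F p r then p * s else 0) + (if ¬ F q s ∧ ¬ F r s then q * r else 0) +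
    (if ¬ F q r then q * s else 0) + r * s +
    (if ¬ F p s ∧ ¬ F q s ∧ ¬ F r s then p * q * r else 0) +
    (if ¬ F p r ∧ ¬ F q r then p * q * s else 0) + (if ¬ F p q then p * r * s else 0) +
    q * r * s + p * q * r * s := by
  have n1 := hpq.ne
  have n2 := hqr.ne
  have n3 := hrs.ne
  have n4 := (hpq.trans hqr).ne
  have n5 := (hqr.trans hrs).ne
  have n6 := (hpq.trans (hqr.trans hrs)).ne
  have f1 := hF q (by simp) p (by simp) hpq
  have f2 := hF r (by simp) q (by simp) hqr
  have f3 := hF s (by simp) r (by simp) hrs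
  have f4 := hF r (by simp) p (by simp) (hpq.trans hqr)
  have f5 := hF s (by simp) q (by simp) (hqr.trans hrs)
  have f6 := hF s (by simp) p (by simp) (hpq.trans (hqr.trans hrs))
  rw [Finset.sum_powerset_four n1 n4 n6 n2 n5 n3]
  simp [Finset.prod_insert, n1, n2, n3, n4, n5, n6, n1.symm, n2.symm, n3.symm, n4.symm, n5.symm,
    n6.symm, f1, f2, f3, f4, f5, f6]
  simp only [and_assoc, mul_assoc]
  ring

set_option linter.unusedSimpArgs false in
-- Only two properties of forcing matter: `a ∣ b - 1`, which makes it increasing, and the absence of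
-- chains. Each prime is then either a source or a target, and every configuration falls under one
-- of the Diophantine lemmas.
theorem sum_powerset_closed_ne_two_mul {p q r s : ℕ} (hp : p.Prime) (hq : q.Prime) (hr : r.Prime)
    (hs : s.Prime) (F : ℕ → ℕ → Prop) (hpq : p < q) (hqr : q < r) (hrs : r < s)
    (hdvd : ∀ a ∈ ({p, q, r, s} : Finset ℕ), ∀ b ∈ ({p, q, r, s} : Finset ℕ), a ≠ b →
      F a b → a ∣ b - 1)
    (hht : ∀ a ∈ ({p, q, r, s} : Finset ℕ), ∀ b ∈ ({p, q, r, s} : Finset ℕ),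
      ∀ c ∈ ({p, q, r, s} : Finset ℕ), a ≠ b → b ≠ c → F a b → ¬ F b c) :
    (∑ S ∈ ({p, q, r, s} : Finset ℕ).powerset,
      open Classical in
      if ∀ a ∈ S, ∀ b ∈ ({p, q, r, s} : Finset ℕ), F a b → b ∈ S then ∏ a ∈ S, a else 0) ≠
    2 * (p * q * r * s) := by
  have hpr := hpq.trans hqr
  have hqs := hqr.trans hrs
  have hps := hpq.trans hqs
  have hpos : ∀ b ∈ ({p, q, r, s} : Finset ℕ), 2 ≤ b := by
    simp [hp.two_le, hq.two_le, hr.two_le, hs.two_le]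
  have hF : ∀ a ∈ ({p, q, r, s} : Finset ℕ), ∀ b ∈ ({p, q, r, s} : Finset ℕ),
      b < a → ¬ F a b := by
    intro a ha b hb hab h
    have h1 := hpos b hb
    have h2 := Nat.le_of_dvd (by omega) (hdvd a ha b hb hab.ne' h)
    omega
  rw [sum_powerset_closed_of_four F hpq hqr hrs hF]
  have dpq := hdvd p (by simp) q (by simp) hpq.ne
  have dpr := hdvd p (by simp) r (by simp) hpr.ne
  have dps := hdvd p (by simp) s (by simp) hps.ne
  have dqr := hdvd q (by simp) r (by simp) hqr.ne
  have dqs := hdvd q (by simp) s (by simp) hqs.ne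
  have drs := hdvd r (by simp) s (by simp) hrs.ne
  have bpqr := hht p (by simp) q (by simp) r (by simp) hpq.ne hqr.ne
  have bpqs := hht p (by simp) q (by simp) s (by simp) hpq.ne hqs.ne
  have bprs := hht p (by simp) r (by simp) s (by simp) hpr.ne hrs.ne
  have bqrs := hht q (by simp) r (by simp) s (by simp) hqr.ne hrs.ne
  intro h
  by_cases ipq : F p q
  · by_cases ipr : F p r
    · have iqr := bpqr ipq
      have irs := bprs ipr
      by_cases ips : F p s
      · have iqs := bpqs ipq
        simp only [ipq, ipr, iqr, irs, ips, iqs, not_true, not_false_iff, and_true, and_false,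
          if_true, if_false] at h
        exact prod_add_prod_succ_ne_two_mul_prod hp hq hr hs hpq hpr hps (by linarith)
      · have iqs := bpqs ipq
        simp only [ipq, ipr, iqr, irs, ips, iqs, not_true, not_false_iff, and_true, and_false,
          if_true, if_false] at h
        exact two_lower_common_upper hp hq hs hr hpq hpr hqr.ne (by linarith)
    · have iqr := bpqr ipq
      by_cases irs : F r s
      · by_cases ips : F p s
        · have iqs := bpqs ipq
          simp only [ipq, ipr, iqr, irs, ips, iqs, not_true, not_false_iff, and_true, and_false,
            if_true, if_false] at h
          exact two_lower_nested_uppers hp hr hpr.ne hpq hps hrs (by linarith)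
        · have iqs := bpqs ipq
          simp only [ipq, ipr, iqr, irs, ips, iqs, not_true, not_false_iff, and_true, and_false,
            if_true, if_false] at h
          exact two_lower_distinct_uppers hp hq hr hs hpr.ne hpq hrs (dpq ipq) (drs irs)
            (by linarith)
      · by_cases ips : F p s
        · have iqs := bpqs ipq
          simp only [ipq, ipr, iqr, irs, ips, iqs, not_true, not_false_iff, and_true, and_false,
            if_true, if_false] at h
          exact two_lower_common_upper hp hq hr hs hpq hps hqs.ne (by linarith)
        · have iqs := bpqs ipq
          simp only [ipq, ipr, iqr, irs, ips, iqs, not_true, not_false_iff, and_true, and_false,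
            if_true, if_false] at h
          exact one_lower_one_upper hp hq hr hs hpq (hpr.ne) (hps.ne) (hrs.ne) (by linarith)
  · by_cases ipr : F p r
    · by_cases iqr : F q r
      · have irs := bqrs iqr
        by_cases ips : F p s
        · by_cases iqs : F q s
          · simp only [ipq, ipr, iqr, irs, ips, iqs, not_true, not_false_iff, and_true, and_false,
              if_true, if_false] at h
            exact two_lower_two_common_uppers hp hr hs hpr hps hrs.ne (c := q) (by linarith)
          · simp only [ipq, ipr, iqr, irs, ips, iqs, not_true, not_false_iff, and_true, and_false,
              if_true, if_false] at h
            exact two_lower_nested_uppers hp hq hpq.ne hps hpr hqr (by linarith)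
        · by_cases iqs : F q s
          · simp only [ipq, ipr, iqr, irs, ips, iqs, not_true, not_false_iff, and_true, and_false,
              if_true, if_false] at h
            exact two_lower_nested_uppers hq hp hpq.ne' hqs hqr hpr (by linarith)
          · simp only [ipq, ipr, iqr, irs, ips, iqs, not_true, not_false_iff, and_true, and_false,
              if_true, if_false] at h
            exact one_lower_two_upper hp hr hq hpr hqr hpq.ne (dpr ipr) (dqr iqr) (e := s)
              (by linarith)
      · have irs := bprs ipr
        by_cases ips : F p s
        · by_cases iqs : F q s
          · simp only [ipq, ipr, iqr, irs, ips, iqs, not_true, not_false_iff, and_true, and_false,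
              if_true, if_false] at h
            exact two_lower_nested_uppers hp hq hpq.ne hpr hps hqs (by linarith)
          · simp only [ipq, ipr, iqr, irs, ips, iqs, not_true, not_false_iff, and_true, and_false,
              if_true, if_false] at h
            exact two_lower_common_upper hp hr hq hs hpr hps hrs.ne (by linarith)
        · by_cases iqs : F q s
          · simp only [ipq, ipr, iqr, irs, ips, iqs, not_true, not_false_iff, and_true, and_false,
              if_true, if_false] at h
            exact two_lower_distinct_uppers hp hr hq hs hpq.ne hpr hqs (dpr ipr) (dqs iqs)
              (by linarith)
          · simp only [ipq, ipr, iqr, irs, ips, iqs, not_true, not_false_iff, and_true, and_false,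
              if_true, if_false] at h
            exact one_lower_one_upper hp hr hq hs hpr (hpq.ne) (hps.ne) (hqs.ne) (by linarith)
    · by_cases iqr : F q r
      · have irs := bqrs iqr
        by_cases ips : F p s
        · by_cases iqs : F q s
          · simp only [ipq, ipr, iqr, irs, ips, iqs, not_true, not_false_iff, and_true, and_false,
              if_true, if_false] at h
            exact two_lower_nested_uppers hq hp hpq.ne' hqr hqs hps (by linarith)
          · simp only [ipq, ipr, iqr, irs, ips, iqs, not_true, not_false_iff, and_true, and_false,
              if_true, if_false] at h
            exact two_lower_distinct_uppers hq hr hp hs hpq.ne' hqr hps (dqr iqr) (dps ips)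
              (by linarith)
        · by_cases iqs : F q s
          · simp only [ipq, ipr, iqr, irs, ips, iqs, not_true, not_false_iff, and_true, and_false,
              if_true, if_false] at h
            exact two_lower_common_upper hq hr hp hs hqr hqs hrs.ne (by linarith)
          · simp only [ipq, ipr, iqr, irs, ips, iqs, not_true, not_false_iff, and_true, and_false,
              if_true, if_false] at h
            exact one_lower_one_upper hq hr hp hs hqr hpq.ne' (hqs.ne) (hps.ne) (by linarith)
      · by_cases irs : F r s
        · by_cases ips : F p s
          · by_cases iqs : F q s
            · simp only [ipq, ipr, iqr, irs, ips, iqs, not_true, not_false_iff, and_true, and_false,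
                if_true, if_false] at h
              exact one_lower_three_upper hs (a := p) (c := q) (e := r) (by linarith)
            · simp only [ipq, ipr, iqr, irs, ips, iqs, not_true, not_false_iff, and_true, and_false,
                if_true, if_false] at h
              exact one_lower_two_upper hp hs hr hps hrs hpr.ne (dps ips) (drs irs) (e := q)
                (by linarith)
          · by_cases iqs : F q s
            · simp only [ipq, ipr, iqr, irs, ips, iqs, not_true, not_false_iff, and_true, and_false,
                if_true, if_false] at h
              exact one_lower_two_upper hq hs hr hqs hrs hqr.ne (dqs iqs) (drs irs) (e := p)
                (by linarith)
            · simp only [ipq, ipr, iqr, irs, ips, iqs, not_true, not_false_iff, and_true, and_false,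
                if_true, if_false] at h
              exact one_lower_one_upper hr hs hp hq hrs (hpr.ne') (hqr.ne') (hpq.ne) (by linarith)
        · by_cases ips : F p s
          · by_cases iqs : F q s
            · simp only [ipq, ipr, iqr, irs, ips, iqs, not_true, not_false_iff, and_true, and_false,
                if_true, if_false] at h
              exact one_lower_two_upper hp hs hq hps hqs hpq.ne (dps ips) (dqs iqs) (e := r)
                (by linarith)
            · simp only [ipq, ipr, iqr, irs, ips, iqs, not_true, not_false_iff, and_true, and_false,
                if_true, if_false] at h
              exact one_lower_one_upper hp hs hq hr hps (hpq.ne) (hpr.ne) (hqr.ne) (by linarith)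
          · by_cases iqs : F q s
            · simp only [ipq, ipr, iqr, irs, ips, iqs, not_true, not_false_iff, and_true, and_false,
                if_true, if_false] at h
              exact one_lower_one_upper hq hs hp hr hqs hpq.ne' (hqr.ne) (hpr.ne) (by linarith)
            · simp only [ipq, ipr, iqr, irs, ips, iqs, not_true, not_false_iff, and_true, and_false,
                if_true, if_false] at h
              exact prod_succ_ne_two_mul_prod hp hq hr hs hpq hpr hps (by linarith)

theorem theorem3p7 {p q r s : ℕ} (hp : p.Prime) (hq : q.Prime) (hr : r.Prime) (hs : s.Prime)
    (hpq : p < q) (hqr : q < r) (hrs : r < s)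
    (G : Type*) [Group G] (hG : Nat.card G = p * q * r * s) :
    ¬ IsLeinster G := by
  rintro ⟨-, h⟩
  have cop {a b : ℕ} (ha : a.Prime) (hb : b.Prime) (hab : a < b) : a.Coprime b :=
    (Nat.coprime_primes ha hb).2 hab.ne
  have c1 : p.Coprime q := cop hp hq hpq
  have c2 : (p * q).Coprime r := (cop hp hr (hpq.trans hqr)).mul_left (cop hq hr hqr)
  have c3 : (p * q * r).Coprime s :=
    ((cop hp hs (hpq.trans (hqr.trans hrs))).mul_left (cop hq hs (hqr.trans hrs))).mul_left
      (cop hr hs hrs)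
  have hsq : Squarefree (Nat.card G) := by
    rw [hG, Nat.squarefree_mul c3, Nat.squarefree_mul c2, Nat.squarefree_mul c1]
    exact ⟨⟨⟨hp.prime.squarefree, hq.prime.squarefree⟩, hr.prime.squarefree⟩, hs.prime.squarefree⟩
  have hpf : (Nat.card G).primeFactors = {p, q, r, s} := by
    rw [hG, c3.primeFactors_mul, c2.primeFactors_mul, c1.primeFactors_mul, hp.primeFactors,
      hq.primeFactors, hr.primeFactors, hs.primeFactors]
    ext x
    simp
  rw [normalSubgroupOrderSum_eq_sum_powerset hsq, hpf, hG] at h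
  refine sum_powerset_closed_ne_two_mul hp hq hr hs (NormalForces G) hpq hqr hrs ?_ ?_ h
  · rw [← hpf]
    exact fun a ha b hb hab hF ↦ hF.dvd_sub_one hsq (Nat.prime_of_mem_primeFactors ha)
      (Nat.prime_of_mem_primeFactors hb) hab (Nat.dvd_of_mem_primeFactors ha)
  · rw [← hpf]
    exact fun a ha b hb c hc hab hbc hF ↦ hF.not_normalForces hsq
      (Nat.prime_of_mem_primeFactors ha) (Nat.prime_of_mem_primeFactors hb) hab
      (Nat.dvd_of_mem_primeFactors ha) (Nat.prime_of_mem_primeFactors hc) hbc
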